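/- Let $X$ and $Y$ be disjoint finite sets and let $G$ be a bipartite graph with sides $X$ and $Y$ and edge set $E \subseteq X \times Y$, with a weight function $w : E \to \mathbb{R}$ and a capacity function $c : X \to \mathbb{Z}$ with $c(x) \ge 0$ for all $x \in X$. Suppose that every vertex $y \in Y$ has degree at most $p$ in $G$. For $S \subseteq X$, a capacity-respecting matching in the subgraph induced by $S \cup Y$ is a set $M$ of edges between $S$ and $Y$ such that each $x \in S$ belongs to at most $c(x)$ edges of $M$ and each $y \in Y$ belongs to at most one edge of $M$. Let $v(S)$ be the maximum of $\sum_{e \in M} w(e)$ over all such $M$. Then the maximum defining $v(S)$ exists for every $S \subseteq X$, and the following hold. 1. (Weighted-B-Matching is the maximization of $v$.) For an integer $K \ge 0$, the Weighted-B-Matching problem asks for a set $M \subseteq E$ of maximum total weight such that each $x \in X$ belongs to at most $c(x)$ edges of $M$, each $y \in Y$ belongs to at most one edge of $M$, and at most $K$ vertices of $X$ belong to some edge of $M$. For every $K$, the optimal value of this problem equals $\max\{v(S) : S \subseteq X,\ |S| \le K\}$, and $M$ is an optimal solution if and only if there is a set $S$ attaining this last maximum such that $M$ is a maximum-weight capacity-respecting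 matching in the subgraph induced by $S \cup Y$. 2. $v$ is non-negative: $v(S) \ge 0$ for all $S \subseteq X$. 3. $v$ is non-decreasing: $v(A) \le v(B)$ whenever $A \subseteq B \subseteq X$. 4. $v$ is submodular: $v(A \cup \{x\}) - v(A) \ge v(B \cup \{x\}) - v(B)$ whenever $A \subseteq B \subseteq X$ and $x \in X \setminus B$. 5. $v$ is $p$-superseparable: for every $S \subseteq X$, $$\sum_{x \in X} \bigl(v(S \cup \{x\}) - v(S)\bigr) \ \ge\ \sum_{x \in X} v(\{x\}) - p \cdot v(S).$$ -/

import Mathlib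

/-- Submodularity of a set function: diminishing marginal contributions. -/
def IsSubmodular {X : Type*} [DecidableEq X] (v : Finset X → ℝ) : Prop :=
  ∀ A B : Finset X, A ⊆ B → ∀ x : X, x ∉ B → v (B ∪ {x}) - v B ≤ v (A ∪ {x}) - v A

/-- The inequality of `p`-superseparability of a set function on a finite universe. -/
def IsSuperseparable {X : Type*} [Fintype X] [DecidableEq X] (p : ℝ) (v : Finset X → ℝ) : Prop :=
  ∀ S : Finset X, (∑ x : X, v {x}) - p * v S ≤ ∑ x : X, (v (S ∪ {x}) - v S)

/-- `S` has at most `K` elements and maximal value of `v` among all such sets. -/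
def IsBestKSubset {X : Type*} (v : Finset X → ℝ) (K : ℕ) (S : Finset X) : Prop :=
  S.card ≤ K ∧ ∀ T : Finset X, T.card ≤ K → v T ≤ v S

/-- The data of a weighted b-matching instance: a bipartite graph with sides `X` and `Y`, edge
weights (only the values on `edges` are ever used), and capacities on `X`. -/
structure BMatchingInstance (X Y : Type*) where
  edges : Finset (X × Y)
  weight : X × Y → ℝ
  capacity : X → ℤ

namespace BMatchingInstance

variable {X Y : Type*} [DecidableEq X] [DecidableEq Y] (I : BMatchingInstance X Y)

/-- The number of edges at the vertex `y`. -/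
def degreeY (y : Y) : ℕ := (I.edges.filter fun e => e.2 = y).card

/-- Total weight of a set of edges. -/
def totalWeight (M : Finset (X × Y)) : ℝ := ∑ e ∈ M, I.weight e

/-- The edges of the subgraph induced by `S ∪ Y`. -/
def inducedEdges (S : Finset X) : Finset (X × Y) := I.edges.filter fun e => e.1 ∈ S

/-- `M` is a capacity-respecting matching in the subgraph induced by `S ∪ Y`. -/
def IsMatching (S : Finset X) (M : Finset (X × Y)) : Prop :=
  M ⊆ I.inducedEdges S ∧
  (∀ x ∈ S, ((M.filter fun e => e.1 = x).card : ℤ) ≤ I.capacity x) ∧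
  ∀ y : Y, (M.filter fun e => e.2 = y).card ≤ 1

/-- `M` is a maximum-weight capacity-respecting matching in the subgraph induced by `S ∪ Y`. -/
def IsMaxMatching (S : Finset X) (M : Finset (X × Y)) : Prop :=
  I.IsMatching S M ∧ ∀ N, I.IsMatching S N → I.totalWeight N ≤ I.totalWeight M

/-- The maximum weight of a capacity-respecting matching in the subgraph induced by `S ∪ Y`. -/
noncomputable def value (S : Finset X) : ℝ :=
  sSup {r : ℝ | ∃ M, I.IsMatching S M ∧ I.totalWeight M = r}

/-- Feasible solutions of the weighted b-matching problem with bound `K` on the number of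
vertices of `X` that are used. -/
def IsFeasible (K : ℕ) (M : Finset (X × Y)) : Prop :=
  M ⊆ I.edges ∧
  (∀ x : X, ((M.filter fun e => e.1 = x).card : ℤ) ≤ I.capacity x) ∧
  (∀ y : Y, (M.filter fun e => e.2 = y).card ≤ 1) ∧
  (M.image Prod.fst).card ≤ K

/-- Optimal solutions of the weighted b-matching problem with bound `K`. -/
def IsOptimal (K : ℕ) (M : Finset (X × Y)) : Prop :=
  I.IsFeasible K M ∧ ∀ N, I.IsFeasible K N → I.totalWeight N ≤ I.totalWeight M

end BMatchingInstance

/-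
Submodularity is proved in the form `v (S ∪ T) + v (S ∩ T) ≤ v S + v T`: optimal matchings `M` of
`S ∪ T` and `N` of `S ∩ T` are redistributed into a matching of `S` and one of `T`. A set `R ⊆ M`
containing the edges at `T \ S` moves to the `T` side, and the edges of `N` that meet `R` in `Y`
take its place. Starting from the edges at `T \ S`, one keeps adding to `R` an edge of `M` at a
vertex of `S ∩ T` where the replacement of `R` has more edges than `R` does; a maximal such `R`
overloads neither side.

For superseparability, an optimal matching of `{x}` can be added to an optimal matching `M` of `S`
once the edges of `M` at neighbours of `x` are deleted. Summed over `x`, each edge of `M` is deleted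
at most `p` times, and its weight is non-negative since `M` is optimal.
-/

namespace BMatchingInstance

variable {X Y : Type*}

lemma exists_max_totalWeight {I : BMatchingInstance X Y} {P : Finset (X × Y) → Prop}
    (hedges : ∀ M, P M → M ⊆ I.edges) (hP : ∃ M, P M) :
    ∃ M, P M ∧ ∀ N, P N → I.totalWeight N ≤ I.totalWeight M :=
  Set.exists_max_image {M | P M} I.totalWeight
    (I.edges.powerset.finite_toSet.subset fun M hM =>
      Finset.mem_coe.2 (Finset.mem_powerset.2 (hedges M hM))) hP

lemma isGreatest_totalWeight {I : BMatchingInstance X Y} {P : Finset (X × Y) → Prop}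
    {M : Finset (X × Y)} (hM : P M ∧ ∀ N, P N → I.totalWeight N ≤ I.totalWeight M) :
    IsGreatest {r : ℝ | ∃ N, P N ∧ I.totalWeight N = r} (I.totalWeight M) := by
  refine ⟨⟨M, hM.1, rfl⟩, ?_⟩
  rintro _ ⟨N, hN, rfl⟩
  exact hM.2 N hN

section

variable [DecidableEq X]

/-- The degree of `x` in the set of edges `M`; it unfolds to the expression bounded by the capacity
in `IsMatching` and `IsFeasible`. -/
def fstDegree (M : Finset (X × Y)) (x : X) : ℕ := (M.filter fun e => e.1 = x).card

lemma fstDegree_mono {M N : Finset (X × Y)} (h : M ⊆ N) (x : X) :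
    fstDegree M x ≤ fstDegree N x :=
  Finset.card_le_card (Finset.filter_subset_filter _ h)

lemma fstDegree_eq_zero_iff {M : Finset (X × Y)} {x : X} :
    fstDegree M x = 0 ↔ ∀ e ∈ M, e.1 ≠ x := by
  rw [fstDegree, Finset.card_eq_zero, Finset.filter_eq_empty_iff]

end

section

variable [DecidableEq Y]

/-- The edges of `N` that share their endpoint in `Y` with some edge of `R`: those that have to give
way when `R` is added to `N`. -/
def conflicting (N R : Finset (X × Y)) : Finset (X × Y) :=
  N.filter fun e => e.2 ∈ R.image Prod.snd

lemma conflicting_subset (N R : Finset (X × Y)) : conflicting N R ⊆ N :=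
  Finset.filter_subset _ _

lemma conflicting_mono (N : Finset (X × Y)) {R R' : Finset (X × Y)} (h : R ⊆ R') :
    conflicting N R ⊆ conflicting N R' :=
  Finset.monotone_filter_right N fun _ _ he => Finset.image_subset_image h he

lemma image_snd_conflicting_subset (N R : Finset (X × Y)) :
    (conflicting N R).image Prod.snd ⊆ R.image Prod.snd :=
  Finset.image_subset_iff.2 fun _ he => (Finset.mem_filter.1 he).2

end

variable [DecidableEq X] [DecidableEq Y]

lemma fstDegree_union_le (M N : Finset (X × Y)) (x : X) :
    fstDegree (M ∪ N) x ≤ fstDegree M x + fstDegree N x := by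
  rw [fstDegree, Finset.filter_union]
  exact Finset.card_union_le _ _

lemma fstDegree_sdiff_add {M N : Finset (X × Y)} (h : N ⊆ M) (x : X) :
    fstDegree (M \ N) x + fstDegree N x = fstDegree M x := by
  rw [fstDegree, fstDegree, ← Finset.card_union_of_disjoint
    (Finset.disjoint_filter_filter Finset.sdiff_disjoint), ← Finset.filter_union,
    Finset.sdiff_union_of_subset h, fstDegree]

lemma fstDegree_insert_self_le (M : Finset (X × Y)) (e : X × Y) :
    fstDegree (insert e M) e.1 ≤ fstDegree M e.1 + 1 := by
  rw [fstDegree, Finset.filter_insert, if_pos rfl]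
  exact Finset.card_insert_le _ _

lemma fstDegree_insert_of_ne (M : Finset (X × Y)) {e : X × Y} {x : X} (h : e.1 ≠ x) :
    fstDegree (insert e M) x = fstDegree M x := by
  rw [fstDegree, Finset.filter_insert, if_neg h, fstDegree]

lemma disjoint_image_snd_sdiff_conflicting (N R : Finset (X × Y)) :
    Disjoint (R.image Prod.snd) ((N \ conflicting N R).image Prod.snd) := by
  rw [conflicting, ← Finset.filter_not]
  refine Finset.disjoint_right.2 fun y hy => ?_
  obtain ⟨e, he, rfl⟩ := Finset.mem_image.1 hy
  exact (Finset.mem_filter.1 he).2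

lemma fstDegree_insert_le_conflicting {N R : Finset (X × Y)} {e : X × Y} {u : X}
    (hR : fstDegree R u ≤ fstDegree (conflicting N R) u)
    (he : fstDegree R e.1 < fstDegree (conflicting N R) e.1) :
    fstDegree (insert e R) u ≤ fstDegree (conflicting N (insert e R)) u := by
  refine le_trans ?_ (fstDegree_mono (conflicting_mono N (Finset.subset_insert e R)) u)
  by_cases heu : e.1 = u
  · subst heu
    exact (fstDegree_insert_self_le R e).trans he
  · rwa [fstDegree_insert_of_ne R heu]

lemma exists_subset_fstDegree_le_conflicting {A : Finset X} {M N R₀ : Finset (X × Y)} {c : X → ℤ}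
    (hR₀ : R₀ ⊆ M) (hR₀A : ∀ e ∈ R₀, e.1 ∉ A) (hM : ∀ u ∈ A, fstDegree M u ≤ c u)
    (hN : ∀ u ∈ A, fstDegree N u ≤ c u) :
    ∃ R, R₀ ⊆ R ∧ R ⊆ M ∧ (∀ e ∈ R, e ∈ R₀ ∨ e.1 ∈ A) ∧
      (∀ u ∈ A, fstDegree R u ≤ fstDegree (conflicting N R) u) ∧
      ∀ u ∈ A, (fstDegree (M \ R) u + fstDegree (conflicting N R) u : ℤ) ≤ c u := by
  let IsCandidate (R : Finset (X × Y)) : Prop := R ⊆ M ∧ (∀ e ∈ R, e ∈ R₀ ∨ e.1 ∈ A) ∧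
    ∀ u ∈ A, fstDegree R u ≤ fstDegree (conflicting N R) u
  have hfin : {R | IsCandidate R}.Finite :=
    M.powerset.finite_toSet.subset fun R hR => Finset.mem_coe.2 (Finset.mem_powerset.2 hR.1)
  have hcand₀ : IsCandidate R₀ := by
    refine ⟨hR₀, fun e he => .inl he, fun u hu => ?_⟩
    rw [fstDegree_eq_zero_iff.2 fun e he heu => hR₀A e he (heu ▸ hu)]
    exact Nat.zero_le _
  obtain ⟨R, hR₀R, ⟨hRM, hRA, hdeg⟩, hmax⟩ := hfin.exists_le_maximal hcand₀
  refine ⟨R, hR₀R, hRM, hRA, hdeg, fun u hu => ?_⟩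
  by_contra! hover
  have hsplit := fstDegree_sdiff_add hRM u
  have hconf := fstDegree_mono (conflicting_subset N R) u
  have hMu := hM u hu
  have hNu := hN u hu
  have hroom : fstDegree R u < fstDegree (conflicting N R) u := by lia
  have hleft : fstDegree (M \ R) u ≠ 0 := by lia
  obtain ⟨e, heMR, rfl⟩ : ∃ e ∈ M \ R, e.1 = u := by
    simpa [fstDegree_eq_zero_iff] using hleft
  obtain ⟨heM, heR⟩ := Finset.mem_sdiff.1 heMR
  have hcand : IsCandidate (insert e R) :=
    ⟨Finset.insert_subset heM hRM, Finset.forall_mem_insert _ _ _ |>.2 ⟨.inr hu, hRA⟩,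
      fun t ht => fstDegree_insert_le_conflicting (hdeg t ht) hroom⟩
  exact heR (hmax hcand (Finset.subset_insert e R) (Finset.mem_insert_self e R))

variable {I : BMatchingInstance X Y} {K : ℕ} {S T : Finset X} {M N : Finset (X × Y)}

lemma totalWeight_union (h : Disjoint (M.image Prod.snd) (N.image Prod.snd)) :
    I.totalWeight (M ∪ N) = I.totalWeight M + I.totalWeight N :=
  Finset.sum_union h.of_image_finset

lemma totalWeight_sdiff_add (h : N ⊆ M) :
    I.totalWeight (M \ N) + I.totalWeight N = I.totalWeight M :=
  Finset.sum_sdiff h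

lemma IsMatching.subset_edges (h : I.IsMatching S M) : M ⊆ I.edges :=
  h.1.trans (Finset.filter_subset _ _)

lemma IsMatching.fst_mem (h : I.IsMatching S M) {e : X × Y} (he : e ∈ M) : e.1 ∈ S :=
  (Finset.mem_filter.1 (h.1 he)).2

lemma IsMatching.injOn_snd (h : I.IsMatching S M) : Set.InjOn Prod.snd (M : Set (X × Y)) :=
  fun e he f hf hef => Finset.card_le_one.1 (h.2.2 f.2) e (Finset.mem_filter.2 ⟨he, hef⟩) f
    (Finset.mem_filter.2 ⟨hf, rfl⟩)

lemma IsMatching.fstDegree_eq_zero (h : I.IsMatching S M) {x : X} (hx : x ∉ S) :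
    fstDegree M x = 0 :=
  fstDegree_eq_zero_iff.2 fun _ he hex => hx (hex ▸ h.fst_mem he)

lemma IsMatching.fstDegree_le (hc : 0 ≤ I.capacity) (h : I.IsMatching S M) (x : X) :
    fstDegree M x ≤ I.capacity x := by
  by_cases hx : x ∈ S
  · exact h.2.1 x hx
  · rw [h.fstDegree_eq_zero hx]
    exact hc x

lemma isMatching_of_injOn (hE : M ⊆ I.edges) (hS : ∀ e ∈ M, e.1 ∈ S)
    (hX : ∀ x ∈ S, fstDegree M x ≤ I.capacity x)
    (hY : Set.InjOn Prod.snd (M : Set (X × Y))) : I.IsMatching S M := by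
  refine ⟨fun e he => Finset.mem_filter.2 ⟨hE he, hS e he⟩, hX,
    fun y => Finset.card_le_one.2 fun e he f hf => ?_⟩
  rw [Finset.mem_filter] at he hf
  exact hY he.1 hf.1 (he.2.trans hf.2.symm)

lemma IsMatching.subset (h : I.IsMatching S M) (hNM : N ⊆ M) : I.IsMatching S N :=
  isMatching_of_injOn (hNM.trans h.subset_edges) (fun _ he => h.fst_mem (hNM he))
    (fun x hx => (Int.ofNat_le.2 (fstDegree_mono hNM x)).trans (h.2.1 x hx))
    (h.injOn_snd.mono hNM)

lemma IsMatching.mono (hc : 0 ≤ I.capacity) (h : I.IsMatching S M) (hST : S ⊆ T) :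
    I.IsMatching T M :=
  isMatching_of_injOn h.subset_edges (fun _ he => hST (h.fst_mem he))
    (fun x _ => h.fstDegree_le hc x) h.injOn_snd

lemma isMatching_empty (hc : 0 ≤ I.capacity) (S : Finset X) : I.IsMatching S ∅ :=
  isMatching_of_injOn (Finset.empty_subset _) (by simp) (fun x _ => hc x) (by simp)

lemma IsMatching.union {U : Finset X} (hM : I.IsMatching S M) (hN : I.IsMatching T N)
    (hU : ∀ e ∈ M ∪ N, e.1 ∈ U)
    (hX : ∀ x ∈ U, (fstDegree M x + fstDegree N x : ℤ) ≤ I.capacity x)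
    (hY : Disjoint (M.image Prod.snd) (N.image Prod.snd)) : I.IsMatching U (M ∪ N) := by
  refine isMatching_of_injOn (Finset.union_subset hM.subset_edges hN.subset_edges) hU
    (fun x hx => le_trans (mod_cast fstDegree_union_le M N x) (hX x hx)) ?_
  rw [Finset.coe_union, Set.injOn_union (mod_cast hY.of_image_finset)]
  exact ⟨hM.injOn_snd, hN.injOn_snd, fun e he f hf => Finset.disjoint_iff_ne.1 hY _
    (Finset.mem_image_of_mem _ he) _ (Finset.mem_image_of_mem _ hf)⟩

lemma IsMatching.disjoint_image_snd_conflicting {R : Finset (X × Y)} (hM : I.IsMatching S M)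
    (hR : R ⊆ M) (N : Finset (X × Y)) :
    Disjoint ((M \ R).image Prod.snd) ((conflicting N R).image Prod.snd) := by
  rw [Finset.image_sdiff_of_injOn hM.injOn_snd hR]
  exact Finset.sdiff_disjoint.mono_right (image_snd_conflicting_subset N R)

lemma exists_isMaxMatching (hc : 0 ≤ I.capacity) (S : Finset X) : ∃ M, I.IsMaxMatching S M :=
  exists_max_totalWeight (fun _ hM => hM.subset_edges) ⟨∅, isMatching_empty hc S⟩

lemma IsMaxMatching.totalWeight_eq (h : I.IsMaxMatching S M) : I.totalWeight M = I.value S :=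
  (isGreatest_totalWeight h).csSup_eq.symm

lemma isGreatest_value (hc : 0 ≤ I.capacity) (S : Finset X) :
    IsGreatest {r : ℝ | ∃ M, I.IsMatching S M ∧ I.totalWeight M = r} (I.value S) := by
  obtain ⟨M, hM⟩ := exists_isMaxMatching hc S
  exact hM.totalWeight_eq ▸ isGreatest_totalWeight hM

lemma IsMatching.totalWeight_le_value (hc : 0 ≤ I.capacity) (h : I.IsMatching S M) :
    I.totalWeight M ≤ I.value S :=
  (isGreatest_value hc S).2 ⟨M, h, rfl⟩

lemma IsMaxMatching.weight_nonneg (h : I.IsMaxMatching S M) {e : X × Y} (he : e ∈ M) :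
    0 ≤ I.weight e := by
  have herase : I.totalWeight (M.erase e) ≤ I.totalWeight M :=
    h.2 _ (h.1.subset (M.erase_subset e))
  rw [totalWeight, totalWeight, ← Finset.add_sum_erase M I.weight he] at herase
  exact le_add_iff_nonneg_left _ |>.1 herase

lemma value_nonneg (hc : 0 ≤ I.capacity) (S : Finset X) : 0 ≤ I.value S :=
  (isMatching_empty hc S).totalWeight_le_value hc

lemma value_mono (hc : 0 ≤ I.capacity) : Monotone I.value := by
  intro S T hST
  obtain ⟨M, hM⟩ := exists_isMaxMatching hc S
  rw [← hM.totalWeight_eq]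
  exact (hM.1.mono hc hST).totalWeight_le_value hc

lemma IsMatching.isFeasible (hc : 0 ≤ I.capacity) (h : I.IsMatching S M) (hS : S.card ≤ K) :
    I.IsFeasible K M :=
  ⟨h.subset_edges, h.fstDegree_le hc, h.2.2,
    (Finset.card_le_card (Finset.image_subset_iff.2 fun _ he => h.fst_mem he)).trans hS⟩

lemma IsFeasible.isMatching (h : I.IsFeasible K M) : I.IsMatching (M.image Prod.fst) M :=
  ⟨fun _ he => Finset.mem_filter.2 ⟨h.1 he, Finset.mem_image_of_mem _ he⟩,
    fun x _ => h.2.1 x, h.2.2.1⟩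

lemma exists_isOptimal (hc : 0 ≤ I.capacity) (K : ℕ) : ∃ M, I.IsOptimal K M :=
  exists_max_totalWeight (fun _ hM => hM.1)
    ⟨∅, (isMatching_empty hc ∅).isFeasible hc (Nat.zero_le K)⟩

lemma isOptimal_iff (hc : 0 ≤ I.capacity) :
    I.IsOptimal K M ↔ ∃ S : Finset X, IsBestKSubset I.value K S ∧ I.IsMaxMatching S M := by
  constructor
  · rintro ⟨hM, hopt⟩
    have hcard : (M.image Prod.fst).card ≤ K := hM.2.2.2
    refine ⟨M.image Prod.fst, ⟨hcard, fun T hT => ?_⟩, hM.isMatching,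
      fun N hN => hopt N (hN.isFeasible hc hcard)⟩
    obtain ⟨N, hN⟩ := exists_isMaxMatching hc T
    calc I.value T = I.totalWeight N := hN.totalWeight_eq.symm
      _ ≤ I.totalWeight M := hopt N (hN.1.isFeasible hc hT)
      _ ≤ I.value (M.image Prod.fst) := hM.isMatching.totalWeight_le_value hc
  · rintro ⟨S, hS, hM⟩
    refine ⟨hM.1.isFeasible hc hS.1, fun N hN => ?_⟩
    calc I.totalWeight N ≤ I.value (N.image Prod.fst) := hN.isMatching.totalWeight_le_value hc
      _ ≤ I.value S := hS.2 _ hN.2.2.2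
      _ = I.totalWeight M := hM.totalWeight_eq.symm

lemma exists_isGreatest_feasible_and_value (hc : 0 ≤ I.capacity) (K : ℕ) :
    ∃ r : ℝ, IsGreatest {s : ℝ | ∃ M, I.IsFeasible K M ∧ I.totalWeight M = s} r ∧
      IsGreatest {s : ℝ | ∃ S : Finset X, S.card ≤ K ∧ I.value S = s} r := by
  obtain ⟨M, hopt⟩ := exists_isOptimal hc K
  obtain ⟨S, hS, hM⟩ := (isOptimal_iff hc).1 hopt
  refine ⟨I.totalWeight M, isGreatest_totalWeight hopt, ⟨S, hS.1, hM.totalWeight_eq.symm⟩, ?_⟩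
  rintro _ ⟨T, hT, rfl⟩
  exact (hS.2 T hT).trans_eq hM.totalWeight_eq.symm

lemma IsMatching.exists_exchange_subset (hc : 0 ≤ I.capacity) (hM : I.IsMatching (S ∪ T) M)
    (hN : I.IsMatching (S ∩ T) N) :
    ∃ R ⊆ M, (∀ e ∈ M \ R, e.1 ∈ S) ∧ (∀ e ∈ R, e.1 ∈ T) ∧
      (∀ u ∈ S, (fstDegree (M \ R) u + fstDegree (conflicting N R) u : ℤ) ≤ I.capacity u) ∧
      ∀ u ∈ T, (fstDegree R u + fstDegree (N \ conflicting N R) u : ℤ) ≤ I.capacity u := by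
  obtain ⟨R, hR₀R, hRM, hRA, hdeg, hcap⟩ := exists_subset_fstDegree_le_conflicting (A := S ∩ T)
    (M.filter_subset fun e => e.1 ∉ S)
    (fun e he heA => (Finset.mem_filter.1 he).2 (Finset.mem_inter.1 heA).1)
    (fun u _ => hM.fstDegree_le hc u) (fun u _ => hN.fstDegree_le hc u)
  have hCN : conflicting N R ⊆ N := conflicting_subset N R
  refine ⟨R, hRM, fun e he => ?_, fun e he => ?_, fun u hu => ?_, fun u hu => ?_⟩
  · obtain ⟨heM, heR⟩ := Finset.mem_sdiff.1 he
    by_contra heS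
    exact heR (hR₀R (Finset.mem_filter.2 ⟨heM, heS⟩))
  · rcases hRA e he with he₀ | heA
    · exact (Finset.mem_union.1 (hM.fst_mem (hRM he))).resolve_left (Finset.mem_filter.1 he₀).2
    · exact (Finset.mem_inter.1 heA).2
  · by_cases huT : u ∈ T
    · exact hcap u (Finset.mem_inter.2 ⟨hu, huT⟩)
    · rw [(hN.subset hCN).fstDegree_eq_zero fun h => huT (Finset.mem_inter.1 h).2, Nat.cast_zero,
        add_zero]
      exact (hM.subset Finset.sdiff_subset).fstDegree_le hc u
  · by_cases huS : u ∈ S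
    · have hdegu := hdeg u (Finset.mem_inter.2 ⟨huS, hu⟩)
      have hsplit := fstDegree_sdiff_add hCN u
      have hNu := hN.fstDegree_le hc u
      lia
    · rw [(hN.subset Finset.sdiff_subset).fstDegree_eq_zero fun h => huS (Finset.mem_inter.1 h).1,
        Nat.cast_zero, add_zero]
      exact (hM.subset hRM).fstDegree_le hc u

lemma IsMatching.exists_exchange (hc : 0 ≤ I.capacity) (hM : I.IsMatching (S ∪ T) M)
    (hN : I.IsMatching (S ∩ T) N) :
    ∃ P Q, I.IsMatching S P ∧ I.IsMatching T Q ∧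
      I.totalWeight P + I.totalWeight Q = I.totalWeight M + I.totalWeight N := by
  obtain ⟨R, hRM, hMRS, hRT, hcapS, hcapT⟩ := hM.exists_exchange_subset hc hN
  set C := conflicting N R
  have hCN : C ⊆ N := conflicting_subset N R
  have hNST : ∀ e ∈ N, e.1 ∈ S ∧ e.1 ∈ T := fun e he => Finset.mem_inter.1 (hN.fst_mem he)
  have hYS : Disjoint ((M \ R).image Prod.snd) (C.image Prod.snd) :=
    hM.disjoint_image_snd_conflicting hRM N
  have hYT : Disjoint (R.image Prod.snd) ((N \ C).image Prod.snd) :=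
    disjoint_image_snd_sdiff_conflicting N R
  have hP : I.IsMatching S ((M \ R) ∪ C) :=
    (hM.subset Finset.sdiff_subset).union (hN.subset hCN)
      (Finset.forall_mem_union.2 ⟨hMRS, fun e he => (hNST e (hCN he)).1⟩) hcapS hYS
  have hQ : I.IsMatching T (R ∪ (N \ C)) :=
    (hM.subset hRM).union (hN.subset Finset.sdiff_subset)
      (Finset.forall_mem_union.2 ⟨hRT, fun e he => (hNST e (Finset.sdiff_subset he)).2⟩) hcapT hYT
  refine ⟨(M \ R) ∪ C, R ∪ (N \ C), hP, hQ, ?_⟩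
  rw [totalWeight_union hYS, totalWeight_union hYT, ← totalWeight_sdiff_add hRM,
    ← totalWeight_sdiff_add hCN]
  ring

lemma value_union_add_value_inter_le (hc : 0 ≤ I.capacity) (S T : Finset X) :
    I.value (S ∪ T) + I.value (S ∩ T) ≤ I.value S + I.value T := by
  obtain ⟨M, hM⟩ := exists_isMaxMatching hc (S ∪ T)
  obtain ⟨N, hN⟩ := exists_isMaxMatching hc (S ∩ T)
  obtain ⟨P, Q, hP, hQ, hweight⟩ := hM.1.exists_exchange hc hN.1
  rw [← hM.totalWeight_eq, ← hN.totalWeight_eq, ← hweight]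
  exact add_le_add (hP.totalWeight_le_value hc) (hQ.totalWeight_le_value hc)

lemma isSubmodular_value (hc : 0 ≤ I.capacity) : IsSubmodular I.value := by
  intro A B hAB x hx
  have hunion : B ∪ (A ∪ {x}) = B ∪ {x} := by
    rw [← Finset.union_assoc, Finset.union_eq_left.2 hAB]
  have hinter : B ∩ (A ∪ {x}) = A := by
    rw [Finset.inter_union_distrib_left, Finset.inter_eq_right.2 hAB,
      Finset.inter_singleton_of_notMem hx, Finset.union_empty]
  have hlattice := value_union_add_value_inter_le hc B (A ∪ {x})
  rw [hunion, hinter] at hlattice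
  linarith

lemma IsMatching.value_add_totalWeight_le (hc : 0 ≤ I.capacity) (hM : I.IsMatching S M)
    (T : Finset X) :
    I.value T + I.totalWeight (M.filter fun e => ∀ x ∈ T, (x, e.2) ∉ I.edges) ≤
      I.value (S ∪ T) := by
  obtain ⟨L, hL⟩ := exists_isMaxMatching hc T
  set M' := M.filter fun e => ∀ x ∈ T, (x, e.2) ∉ I.edges
  have hM' : I.IsMatching S M' := hM.subset (Finset.filter_subset _ _)
  have hM'T : ∀ e ∈ M', ∀ x ∈ T, (x, e.2) ∉ I.edges := fun e he => (Finset.mem_filter.1 he).2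
  have hY : Disjoint (L.image Prod.snd) (M'.image Prod.snd) := by
    simp only [Finset.disjoint_iff_ne, Finset.forall_mem_image]
    intro e he f hf hef
    exact hM'T f hf e.1 (hL.1.fst_mem he) (hef ▸ hL.1.subset_edges he)
  have hX (u : X) : (fstDegree L u + fstDegree M' u : ℤ) ≤ I.capacity u := by
    by_cases hu : u ∈ T
    · have hzero : fstDegree M' u = 0 := fstDegree_eq_zero_iff.2 fun e he heu =>
        hM'T e he u hu (heu ▸ hM'.subset_edges he)
      rw [hzero, Nat.cast_zero, add_zero]
      exact hL.1.fstDegree_le hc u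
    · rw [hL.1.fstDegree_eq_zero hu, Nat.cast_zero, zero_add]
      exact hM'.fstDegree_le hc u
  have hunion : I.IsMatching (S ∪ T) (L ∪ M') := hL.1.union hM'
    (Finset.forall_mem_union.2 ⟨fun e he => Finset.mem_union_right _ (hL.1.fst_mem he),
      fun e he => Finset.mem_union_left _ (hM'.fst_mem he)⟩) (fun u _ => hX u) hY
  rw [← hL.totalWeight_eq, ← totalWeight_union hY]
  exact hunion.totalWeight_le_value hc

lemma IsMaxMatching.value_singleton_sub_le (hc : 0 ≤ I.capacity) (hM : I.IsMaxMatching S M)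
    (x : X) :
    I.value {x} - I.totalWeight (M.filter fun e => (x, e.2) ∈ I.edges) ≤
      I.value (S ∪ {x}) - I.value S := by
  have hadd := hM.1.value_add_totalWeight_le hc {x}
  simp only [Finset.mem_singleton, forall_eq] at hadd
  have hsplit : I.totalWeight (M.filter fun e => (x, e.2) ∈ I.edges) +
      I.totalWeight (M.filter fun e => (x, e.2) ∉ I.edges) = I.value S :=
    (Finset.sum_filter_add_sum_filter_not M _ _).trans hM.totalWeight_eq
  linarith

lemma card_neighbors_le_degreeY (T : Finset X) (y : Y) :
    (T.filter fun x => (x, y) ∈ I.edges).card ≤ I.degreeY y :=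
  Finset.card_le_card_of_injOn (fun x => (x, y)) (by simp [Set.MapsTo]) (by simp [Set.InjOn])

lemma IsMaxMatching.sum_totalWeight_neighbors_le (hM : I.IsMaxMatching S M) {p : ℝ}
    (hp : ∀ y : Y, (I.degreeY y : ℝ) ≤ p) (T : Finset X) :
    ∑ x ∈ T, I.totalWeight (M.filter fun e => (x, e.2) ∈ I.edges) ≤ p * I.value S := by
  calc ∑ x ∈ T, I.totalWeight (M.filter fun e => (x, e.2) ∈ I.edges)
      = ∑ e ∈ M, (T.filter fun x => (x, e.2) ∈ I.edges).card * I.weight e := by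
        simp only [totalWeight, Finset.sum_filter]
        rw [Finset.sum_comm]
        simp only [← Finset.sum_filter, Finset.sum_const, nsmul_eq_mul]
    _ ≤ ∑ e ∈ M, p * I.weight e := Finset.sum_le_sum fun e he =>
        mul_le_mul_of_nonneg_right
          ((Nat.cast_le.2 (card_neighbors_le_degreeY T e.2)).trans (hp e.2)) (hM.weight_nonneg he)
    _ = p * I.value S := by rw [← Finset.mul_sum, ← hM.totalWeight_eq, totalWeight]

lemma sum_value_singleton_sub_le (hc : 0 ≤ I.capacity) {p : ℝ}
    (hp : ∀ y : Y, (I.degreeY y : ℝ) ≤ p) (T S : Finset X) :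
    (∑ x ∈ T, I.value {x}) - p * I.value S ≤ ∑ x ∈ T, (I.value (S ∪ {x}) - I.value S) := by
  obtain ⟨M, hM⟩ := exists_isMaxMatching hc S
  calc (∑ x ∈ T, I.value {x}) - p * I.value S
      ≤ (∑ x ∈ T, I.value {x}) - ∑ x ∈ T, I.totalWeight (M.filter fun e => (x, e.2) ∈ I.edges) :=
        sub_le_sub_left (hM.sum_totalWeight_neighbors_le hp T) _
    _ = ∑ x ∈ T, (I.value {x} - I.totalWeight (M.filter fun e => (x, e.2) ∈ I.edges)) :=
        Finset.sum_sub_distrib _ _ |>.symm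
    _ ≤ ∑ x ∈ T, (I.value (S ∪ {x}) - I.value S) :=
        Finset.sum_le_sum fun x _ => hM.value_singleton_sub_le hc x

end BMatchingInstance

open BMatchingInstance in
theorem lemma2_general {X Y : Type*} [DecidableEq X] [DecidableEq Y]
    (I : BMatchingInstance X Y) (hc : ∀ x : X, 0 ≤ I.capacity x)
    (p : ℝ) (hp : ∀ y : Y, (I.degreeY y : ℝ) ≤ p) :
    (∀ S : Finset X,
      IsGreatest {r : ℝ | ∃ M, I.IsMatching S M ∧ I.totalWeight M = r} (I.value S)) ∧
    (∀ K : ℕ,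
      (∀ M : Finset (X × Y), I.IsOptimal K M ↔
        ∃ S : Finset X, IsBestKSubset I.value K S ∧ I.IsMaxMatching S M) ∧
      ∃ r : ℝ, IsGreatest {s : ℝ | ∃ M, I.IsFeasible K M ∧ I.totalWeight M = s} r ∧
        IsGreatest {s : ℝ | ∃ S : Finset X, S.card ≤ K ∧ I.value S = s} r) ∧
    (∀ S : Finset X, 0 ≤ I.value S) ∧
    Monotone I.value ∧
    IsSubmodular I.value ∧
    ∀ T S : Finset X,
      (∑ x ∈ T, I.value {x}) - p * I.value S ≤ ∑ x ∈ T, (I.value (S ∪ {x}) - I.value S) :=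
  ⟨isGreatest_value hc,
    fun K => ⟨fun _ => isOptimal_iff hc, exists_isGreatest_feasible_and_value hc K⟩,
    value_nonneg hc, value_mono hc, isSubmodular_value hc, sum_value_singleton_sub_le hc hp⟩

theorem lemma2 {X Y : Type*} [Fintype X] [DecidableEq X] [Fintype Y] [DecidableEq Y]
    (I : BMatchingInstance X Y) (hc : ∀ x : X, 0 ≤ I.capacity x)
    (p : ℝ) (hp : ∀ y : Y, (I.degreeY y : ℝ) ≤ p) :
    -- the maximum defining `value` is attained
    (∀ S : Finset X,
      IsGreatest {r : ℝ | ∃ M, I.IsMatching S M ∧ I.totalWeight M = r} (I.value S)) ∧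
    -- the matching problem is the maximization of `value` over sets of size at most `K`
    (∀ K : ℕ,
      (∀ M : Finset (X × Y), I.IsOptimal K M ↔
        ∃ S : Finset X, IsBestKSubset I.value K S ∧ I.IsMaxMatching S M) ∧
      ∃ r : ℝ, IsGreatest {s : ℝ | ∃ M, I.IsFeasible K M ∧ I.totalWeight M = s} r ∧
        IsGreatest {s : ℝ | ∃ S : Finset X, S.card ≤ K ∧ I.value S = s} r) ∧
    -- the properties of `value`
    (∀ S : Finset X, 0 ≤ I.value S) ∧
    Monotone I.value ∧
    IsSubmodular I.value ∧
    IsSuperseparable p I.value := by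
  obtain ⟨hmax, hK, hnonneg, hmono, hsubmod, hsuper⟩ := lemma2_general I hc p hp
  exact ⟨hmax, hK, hnonneg, hmono, hsubmod, hsuper Finset.univ⟩
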